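/- All graphs are finite, undirected and loopless, and are considered up to isomorphism. For graphs $G,H$ let $G+H$ denote their disjoint union and $GH$ their strong product: the graph on $V(G)\times V(H)$ in which distinct $(u,v)$, $(u',v')$ are adjacent if and only if $u,u'$ are equal or adjacent in $G$ and $v,v'$ are equal or adjacent in $H$. With these operations the (isomorphism classes of) graphs form a commutative semiring, whose zero is the graph without vertices and whose unit is the one-vertex graph, so that $p(G_1,\ldots,G_n)$ is defined for every polynomial $p\in\mathbb{N}[x_1,\ldots,x_n]$, where $\mathbb{N}=\{0,1,2,\ldots\}$. Let $\alpha(G)$ be the maximum cardinality of a set of pairwise nonadjacent vertices of $G$, and let $\Theta(G)=\sup_{k\ge 1}\alpha(G^k)^{1/k}$ be the Shannon capacity of $G$. Theorem. Let $n\ge 0$, let $G_1,\ldots,G_n$ be graphs, each with at least one vertex, and let $$\mathcal{P}=\{p\in\mathbb{N}[x_1,\ldots,x_n] : \Theta(p(G_1,\ldots,G_n))=p(\Theta(G_1),\ldots,\Theta(G_n))\}.$$ Then $\mathcal{P}=\mathbb{N}[x_1,\ldots,x_n]$ if and only if $\mathcal{P}$ contains a polynomial in which all variables $x_1,\ldots,x_n$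 occur. -/

import Mathlib

universe u v

namespace SimpleGraph

/-- The strong product of two graphs: distinct pairs are adjacent iff in each coordinate
their entries are equal or adjacent. -/
def strongProd {V : Type u} {W : Type v} (G : SimpleGraph V) (H : SimpleGraph W) :
    SimpleGraph (V × W) where
  Adj x y := x ≠ y ∧ (x.1 = y.1 ∨ G.Adj x.1 y.1) ∧ (x.2 = y.2 ∨ H.Adj x.2 y.2)
  symm := ⟨fun _ _ h =>
    ⟨h.1.symm, h.2.1.imp Eq.symm (fun a => a.symm), h.2.2.imp Eq.symm (fun a => a.symm)⟩⟩
  loopless := ⟨fun _ h => h.1 rfl⟩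

end SimpleGraph

/-- A finite simple graph (undirected, loopless) together with its vertex set, which may be
empty. -/
structure FinGraph : Type (u + 1) where
  V : Type u
  fin : Finite V
  graph : SimpleGraph V

namespace FinGraph

instance isoSetoid : Setoid FinGraph.{u} where
  r A B := Nonempty (A.graph ≃g B.graph)
  iseqv := ⟨fun _ => ⟨SimpleGraph.Iso.refl⟩, fun ⟨e⟩ => ⟨e.symm⟩, fun ⟨e⟩ ⟨f⟩ => ⟨e.trans f⟩⟩

/-- Disjoint union. -/
def sum (A B : FinGraph.{u}) : FinGraph.{u} :=
  ⟨A.V ⊕ B.V, haveI := A.fin; haveI := B.fin; inferInstance, A.graph.sum B.graph⟩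

/-- Strong product. -/
def prod (A B : FinGraph.{u}) : FinGraph.{u} :=
  ⟨A.V × B.V, haveI := A.fin; haveI := B.fin; inferInstance, A.graph.strongProd B.graph⟩

/-- The graph without vertices. -/
def empty : FinGraph.{u} := ⟨PEmpty.{u + 1}, inferInstance, ⊥⟩

/-- The one-vertex graph. -/
def point : FinGraph.{u} := ⟨PUnit.{u + 1}, inferInstance, ⊥⟩

theorem sum_congr {A A' B B' : FinGraph.{u}} (hA : A ≈ A') (hB : B ≈ B') :
    sum A B ≈ sum A' B' := by
  obtain ⟨e⟩ := hA
  obtain ⟨f⟩ := hB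
  have he (a b : A.V) : A'.graph.Adj (e a) (e b) ↔ A.graph.Adj a b := e.map_adj_iff
  have hf (a b : B.V) : B'.graph.Adj (f a) (f b) ↔ B.graph.Adj a b := f.map_adj_iff
  change Nonempty (A.graph.sum B.graph ≃g A'.graph.sum B'.graph)
  refine ⟨⟨Equiv.sumCongr e.toEquiv f.toEquiv, ?_⟩⟩
  rintro (a | a) (b | b) <;> simp [he, hf]

theorem prod_congr {A A' B B' : FinGraph.{u}} (hA : A ≈ A') (hB : B ≈ B') :
    prod A B ≈ prod A' B' := by
  obtain ⟨e⟩ := hA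
  obtain ⟨f⟩ := hB
  have he (a b : A.V) : A'.graph.Adj (e a) (e b) ↔ A.graph.Adj a b := e.map_adj_iff
  have hf (a b : B.V) : B'.graph.Adj (f a) (f b) ↔ B.graph.Adj a b := f.map_adj_iff
  change Nonempty (A.graph.strongProd B.graph ≃g A'.graph.strongProd B'.graph)
  refine ⟨⟨Equiv.prodCongr e.toEquiv f.toEquiv, ?_⟩⟩
  rintro ⟨a, b⟩ ⟨c, d⟩
  simp [SimpleGraph.strongProd, he, hf]

theorem sum_comm (A B : FinGraph.{u}) : sum A B ≈ sum B A := by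
  change Nonempty (A.graph.sum B.graph ≃g B.graph.sum A.graph)
  refine ⟨⟨Equiv.sumComm _ _, ?_⟩⟩
  rintro (a | a) (b | b) <;> simp

theorem sum_assoc (A B C : FinGraph.{u}) : sum (sum A B) C ≈ sum A (sum B C) := by
  change Nonempty ((A.graph.sum B.graph).sum C.graph ≃g A.graph.sum (B.graph.sum C.graph))
  refine ⟨⟨Equiv.sumAssoc _ _ _, ?_⟩⟩
  rintro ((a | a) | a) ((b | b) | b) <;> simp

theorem empty_sum (A : FinGraph.{u}) : sum empty A ≈ A := by
  change Nonempty ((⊥ : SimpleGraph PEmpty.{u + 1}).sum A.graph ≃g A.graph)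
  refine ⟨⟨Equiv.emptySum PEmpty.{u + 1} A.V, ?_⟩⟩
  rintro (⟨⟨⟩⟩ | a) (⟨⟨⟩⟩ | b)
  simp

theorem prod_comm (A B : FinGraph.{u}) : prod A B ≈ prod B A := by
  change Nonempty (A.graph.strongProd B.graph ≃g B.graph.strongProd A.graph)
  refine ⟨⟨Equiv.prodComm _ _, ?_⟩⟩
  rintro ⟨a, b⟩ ⟨c, d⟩
  simp [SimpleGraph.strongProd]
  tauto

theorem prod_assoc (A B C : FinGraph.{u}) : prod (prod A B) C ≈ prod A (prod B C) := by
  change Nonempty ((A.graph.strongProd B.graph).strongProd C.graph ≃g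
    A.graph.strongProd (B.graph.strongProd C.graph))
  refine ⟨⟨Equiv.prodAssoc _ _ _, ?_⟩⟩
  rintro ⟨⟨a, b⟩, c⟩ ⟨⟨a', b'⟩, c'⟩
  simp [SimpleGraph.strongProd]
  tauto

theorem point_prod (A : FinGraph.{u}) : prod point A ≈ A := by
  change Nonempty ((⊥ : SimpleGraph PUnit.{u + 1}).strongProd A.graph ≃g A.graph)
  refine ⟨⟨Equiv.punitProd A.V, ?_⟩⟩
  rintro ⟨⟨⟩, a⟩ ⟨⟨⟩, b⟩
  have := A.graph.ne_of_adj (a := a) (b := b)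
  simp [SimpleGraph.strongProd]
  tauto

theorem empty_prod (A : FinGraph.{u}) : prod empty A ≈ empty := by
  change Nonempty ((⊥ : SimpleGraph PEmpty.{u + 1}).strongProd A.graph ≃g
    (⊥ : SimpleGraph PEmpty.{u + 1}))
  refine ⟨⟨Equiv.pemptyProd A.V, ?_⟩⟩
  rintro ⟨⟨⟩, a⟩

theorem sum_prod (A B C : FinGraph.{u}) :
    prod (sum A B) C ≈ sum (prod A C) (prod B C) := by
  change Nonempty ((A.graph.sum B.graph).strongProd C.graph ≃g
    (A.graph.strongProd C.graph).sum (B.graph.strongProd C.graph))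
  refine ⟨⟨Equiv.sumProdDistrib _ _ _, ?_⟩⟩
  rintro ⟨a | a, c⟩ ⟨b | b, d⟩ <;> simp [SimpleGraph.strongProd]

/-- The stable set number. -/
noncomputable def stableNumber (A : FinGraph.{u}) : ℕ := A.graph.indepNum

theorem stableNumber_le {A B : FinGraph.{u}} (h : A ≈ B) : stableNumber A ≤ stableNumber B := by
  classical
  obtain ⟨e⟩ := h
  have := B.fin
  obtain ⟨s, hs⟩ := have := A.fin; A.graph.exists_isNIndepSet_indepNum
  have hi : B.graph.IsIndepSet ((s.map e.toEquiv.toEmbedding : Finset B.V) : Set B.V) := by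
    intro x hx y hy hxy hadj
    simp only [Finset.coe_map, Set.mem_image, Finset.mem_coe] at hx hy
    obtain ⟨a, ha, rfl⟩ := hx
    obtain ⟨b, hb, rfl⟩ := hy
    exact hs.isIndepSet ha hb (fun hab => hxy (by rw [hab])) (e.map_adj_iff.1 hadj)
  have := hi.card_le_indepNum
  rwa [Finset.card_map, hs.card_eq] at this

end FinGraph

/-- Isomorphism classes of finite graphs. -/
def GraphClass : Type (u + 1) := Quotient FinGraph.isoSetoid.{u}

namespace GraphClass

/-- The isomorphism class of a finite graph. -/
def of {V : Type u} [h : Finite V] (G : SimpleGraph V) : GraphClass.{u} :=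
  Quotient.mk _ ⟨V, h, G⟩

instance : Add GraphClass.{u} :=
  ⟨Quotient.map₂ FinGraph.sum (fun _ _ h _ _ k => FinGraph.sum_congr h k)⟩

instance : Mul GraphClass.{u} :=
  ⟨Quotient.map₂ FinGraph.prod (fun _ _ h _ _ k => FinGraph.prod_congr h k)⟩

instance : Zero GraphClass.{u} := ⟨Quotient.mk _ FinGraph.empty⟩

instance : One GraphClass.{u} := ⟨Quotient.mk _ FinGraph.point⟩

/-- Isomorphism classes of finite graphs form a commutative semiring: addition is disjoint
union, multiplication is the strong product, `0` is the graph without vertices and `1` is the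
one-vertex graph. -/
instance : CommSemiring GraphClass.{u} where
  nsmul := nsmulRec
  add_assoc := by rintro ⟨a⟩ ⟨b⟩ ⟨c⟩; exact Quotient.sound (FinGraph.sum_assoc a b c)
  add_comm := by rintro ⟨a⟩ ⟨b⟩; exact Quotient.sound (FinGraph.sum_comm a b)
  zero_add := by rintro ⟨a⟩; exact Quotient.sound (FinGraph.empty_sum a)
  add_zero := by
    rintro ⟨a⟩
    exact Quotient.sound (Setoid.trans (FinGraph.sum_comm a _) (FinGraph.empty_sum a))
  mul_assoc := by rintro ⟨a⟩ ⟨b⟩ ⟨c⟩; exact Quotient.sound (FinGraph.prod_assoc a b c)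
  mul_comm := by rintro ⟨a⟩ ⟨b⟩; exact Quotient.sound (FinGraph.prod_comm a b)
  one_mul := by rintro ⟨a⟩; exact Quotient.sound (FinGraph.point_prod a)
  mul_one := by
    rintro ⟨a⟩
    exact Quotient.sound (Setoid.trans (FinGraph.prod_comm a _) (FinGraph.point_prod a))
  zero_mul := by rintro ⟨a⟩; exact Quotient.sound (FinGraph.empty_prod a)
  mul_zero := by
    rintro ⟨a⟩
    exact Quotient.sound (Setoid.trans (FinGraph.prod_comm a _) (FinGraph.empty_prod a))
  right_distrib := by rintro ⟨a⟩ ⟨b⟩ ⟨c⟩; exact Quotient.sound (FinGraph.sum_prod a b c)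
  left_distrib := by
    rintro ⟨a⟩ ⟨b⟩ ⟨c⟩
    exact Quotient.sound (Setoid.trans (FinGraph.prod_comm a _)
      (Setoid.trans (FinGraph.sum_prod b c a)
        (FinGraph.sum_congr (FinGraph.prod_comm b a) (FinGraph.prod_comm c a))))

/-- The stable set number `α`, which is invariant under isomorphism. -/
noncomputable def stableNumber : GraphClass.{u} → ℕ :=
  Quotient.lift FinGraph.stableNumber (fun _ _ h =>
    le_antisymm (FinGraph.stableNumber_le h) (FinGraph.stableNumber_le (Setoid.symm h)))

/-- The Shannon capacity `Θ(G) = sup_{k ≥ 1} α(G ^ k) ^ (1 / k)`; the supremum is over a set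
bounded by the number of vertices. -/
noncomputable def shannonCapacity (x : GraphClass.{u}) : ℝ :=
  ⨆ k : ℕ+, (stableNumber (x ^ (k : ℕ)) : ℝ) ^ (1 / ((k : ℕ) : ℝ))

end GraphClass

/-- The polynomials `p` over `ℕ` in `n` variables with
`Θ(p(G₁, …, Gₙ)) = p(Θ(G₁), …, Θ(Gₙ))`. -/
def capacityPolynomials {n : ℕ} {V : Fin n → Type u} [∀ i, Finite (V i)]
    (G : ∀ i, SimpleGraph (V i)) : Set (MvPolynomial (Fin n) ℕ) :=
  {p | GraphClass.shannonCapacity (MvPolynomial.aeval (fun i => GraphClass.of (G i)) p) =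
    MvPolynomial.aeval (fun i => GraphClass.shannonCapacity (GraphClass.of (G i))) p}


/-!
The stable set number `α` is additive and supermultiplicative on the semiring of graphs. Hence
`Θ` is superadditive and supermultiplicative, so `p(Θ(A)) ≤ Θ(p(A))` for every polynomial `p`;
call `p` exact at `A` when equality holds. As `Θ(A ^ k) = Θ(A) ^ k`, exactness passes to powers,
and superadditivity and supermultiplicativity pass it to summands and to factors by which one may
cancel. Now let `p` be exact. The product of the monomials of `p` is a monomial of a power of `p`,
and every monomial in the variables of `p` divides one of its powers, so all of these monomials are
exact. If `q` has no other variables, then expanding `q ^ k` into monomials and using that `α` is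
additive gives `α(q(A) ^ k) ≤ q(Θ(A)) ^ k` for all `k`, which says that `q` is exact.
-/

section IndepNum

variable {V : Type u} {W : Type v} {G : SimpleGraph V} {H : SimpleGraph W}

theorem isIndepSet_sum_iff {s : Set (V ⊕ W)} :
    (G.sum H).IsIndepSet s ↔ G.IsIndepSet (Sum.inl ⁻¹' s) ∧ H.IsIndepSet (Sum.inr ⁻¹' s) := by
  simp [SimpleGraph.IsIndepSet, Set.Pairwise]

theorem isIndepSet_strongProd {s : Set V} {t : Set W} (hs : G.IsIndepSet s)
    (ht : H.IsIndepSet t) : (G.strongProd H).IsIndepSet (s ×ˢ t) := by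
  rintro ⟨a, b⟩ ⟨ha, hb⟩ ⟨c, d⟩ ⟨hc, hd⟩ hne ⟨-, hac, hbd⟩
  have hac : a = c := hac.elim id fun hadj => by_contra fun h => hs ha hc h hadj
  have hbd : b = d := hbd.elim id fun hadj => by_contra fun h => ht hb hd h hadj
  exact hne (Prod.ext hac hbd)

variable [Finite V] [Finite W] (G H)

theorem indepNum_sum : (G.sum H).indepNum = G.indepNum + H.indepNum := by
  apply le_antisymm
  · obtain ⟨s, hs⟩ := (G.sum H).exists_isNIndepSet_indepNum
    obtain ⟨hl, hr⟩ := isIndepSet_sum_iff.1 hs.isIndepSet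
    have hleft : Sum.inl ⁻¹' (s : Set (V ⊕ W)) = s.toLeft := by ext; simp
    have hright : Sum.inr ⁻¹' (s : Set (V ⊕ W)) = s.toRight := by ext; simp
    rw [hleft] at hl
    rw [hright] at hr
    rw [← hs.card_eq, ← Finset.card_toLeft_add_card_toRight]
    exact add_le_add hl.card_le_indepNum hr.card_le_indepNum
  · obtain ⟨s, hs⟩ := G.exists_isNIndepSet_indepNum
    obtain ⟨t, ht⟩ := H.exists_isNIndepSet_indepNum
    have h : (G.sum H).IsIndepSet (s.disjSum t : Set (V ⊕ W)) :=
      isIndepSet_sum_iff.2 ⟨by simpa [Set.preimage] using hs.isIndepSet,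
        by simpa [Set.preimage] using ht.isIndepSet⟩
    simpa only [Finset.card_disjSum, hs.card_eq, ht.card_eq] using h.card_le_indepNum

theorem indepNum_mul_indepNum_le : G.indepNum * H.indepNum ≤ (G.strongProd H).indepNum := by
  obtain ⟨s, hs⟩ := G.exists_isNIndepSet_indepNum
  obtain ⟨t, ht⟩ := H.exists_isNIndepSet_indepNum
  have h : (G.strongProd H).IsIndepSet (s ×ˢ t : Finset (V × W)) := by
    simpa only [Finset.coe_product] using isIndepSet_strongProd hs.isIndepSet ht.isIndepSet
  simpa only [Finset.card_product, hs.card_eq, ht.card_eq] using h.card_le_indepNum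

theorem indepNum_pos [Nonempty V] : 0 < G.indepNum := by
  obtain ⟨v⟩ := ‹Nonempty V›
  have h : G.IsIndepSet (({v} : Finset V) : Set V) := by simp [SimpleGraph.IsIndepSet]
  exact Nat.succ_le_iff.1 h.card_le_indepNum

theorem indepNum_le_natCard : G.indepNum ≤ Nat.card V := by
  obtain ⟨s, hs⟩ := G.exists_isNIndepSet_indepNum
  rw [← hs.card_eq, ← Set.ncard_coe_finset]
  exact Set.ncard_le_card _

end IndepNum

section Growth

theorem rpow_one_div_pnat_le_iff {x t : ℝ} (hx : 0 ≤ x) (ht : 0 ≤ t) (k : ℕ+) :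
    x ^ (1 / ((k : ℕ) : ℝ)) ≤ t ↔ x ≤ t ^ (k : ℕ) := by
  rw [one_div, Real.rpow_inv_le_iff_of_pos hx ht (by exact_mod_cast k.pos), Real.rpow_natCast]

theorem le_of_forall_mul_pow_le_pow {C x y : ℝ} (hC : 0 < C) (hy : 0 ≤ y)
    (h : ∀ k : ℕ, C * x ^ k ≤ y ^ k) : x ≤ y := by
  by_contra! hyx
  have hx : 0 < x := hy.trans_lt hyx
  obtain ⟨k, hk⟩ := exists_pow_lt_of_lt_one hC ((div_lt_one hx).2 hyx)
  rw [div_pow, div_lt_iff₀ (pow_pos hx k)] at hk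
  exact (h k).not_gt hk

theorem exists_forall_mul_pow_le_of_supermultiplicative {u : ℕ → ℝ} (hone : ∀ k, 1 ≤ u k)
    (hmul : ∀ k l, u k * u l ≤ u (k + l)) {s : ℝ} (hs : 0 ≤ s) {a : ℕ} (ha : a ≠ 0)
    (hsa : s ^ a ≤ u a) : ∃ C > 0, ∀ k, C * s ^ k ≤ u k := by
  have hpow (q r : ℕ) : (s ^ a) ^ q ≤ u (a * q + r) := by
    induction q with
    | zero => simpa using hone r
    | succ q ih =>
      calc (s ^ a) ^ (q + 1) = s ^ a * (s ^ a) ^ q := pow_succ' _ _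
        _ ≤ u a * u (a * q + r) := by gcongr; exact zero_le_one.trans (hone a)
        _ ≤ u (a + (a * q + r)) := hmul _ _
        _ = u (a * (q + 1) + r) := by ring_nf
  refine ⟨(max 1 s ^ a)⁻¹, by positivity, fun k => ?_⟩
  have hrem : s ^ (k % a) ≤ max 1 s ^ a :=
    (pow_le_pow_left₀ hs (le_max_right 1 s) _).trans
      (pow_le_pow_right₀ (le_max_left 1 s) (Nat.mod_lt k ha.bot_lt).le)
  rw [inv_mul_le_iff₀ (by positivity)]
  calc s ^ k = s ^ (k % a) * (s ^ a) ^ (k / a) := by rw [← pow_mul, ← pow_add, Nat.mod_add_div]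
    _ ≤ max 1 s ^ a * u (a * (k / a) + k % a) := by gcongr; exact hpow _ _
    _ = max 1 s ^ a * u k := by rw [Nat.div_add_mod]

theorem le_of_continuousAt_of_forall_mem_Ioo {f : ℝ → ℝ} {a b c : ℝ} (hab : a < b)
    (hf : ContinuousAt f b) (h : ∀ x ∈ Set.Ioo a b, f x ≤ c) : f b ≤ c :=
  le_of_tendsto (hf.mono_left nhdsWithin_le_nhds)
    (Filter.mem_of_superset (Ioo_mem_nhdsLT hab) h)

end Growth

namespace GraphClass

section StableNumber

variable (A B : GraphClass.{u})

theorem stableNumber_add : stableNumber (A + B) = stableNumber A + stableNumber B := by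
  obtain ⟨⟨V, _, G⟩⟩ := A
  obtain ⟨⟨W, _, H⟩⟩ := B
  exact indepNum_sum G H

theorem stableNumber_mul_le : stableNumber A * stableNumber B ≤ stableNumber (A * B) := by
  obtain ⟨⟨V, _, G⟩⟩ := A
  obtain ⟨⟨W, _, H⟩⟩ := B
  exact indepNum_mul_indepNum_le G H

/-- The stable set number as an additive homomorphism, giving access to `map_sum` and
`map_nsmul`. -/
noncomputable def stableNumberHom : GraphClass.{u} →+ ℕ where
  toFun := stableNumber
  map_zero' := by simpa using stableNumber_add (0 : GraphClass.{u}) 0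
  map_add' := stableNumber_add

theorem stableNumber_zero : stableNumber (0 : GraphClass.{u}) = 0 :=
  map_zero stableNumberHom

theorem stableNumber_nsmul (c : ℕ) : stableNumber (c • A) = c * stableNumber A :=
  map_nsmul stableNumberHom c A

theorem stableNumber_sum {ι : Type*} (s : Finset ι) (f : ι → GraphClass.{u}) :
    stableNumber (∑ i ∈ s, f i) = ∑ i ∈ s, stableNumber (f i) :=
  map_sum stableNumberHom f s

/-- The number of vertices of a graph, as a multiplicative homomorphism. It bounds the stable set
number, so that `stableNumber (A ^ k)` grows at most exponentially in `k`. -/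
noncomputable def vertexCount : GraphClass.{u} →* ℕ where
  toFun := Quotient.lift (fun A : FinGraph.{u} => Nat.card A.V)
    fun _ _ ⟨e⟩ => Nat.card_congr e.toEquiv
  map_one' := Nat.card_unique (α := PUnit.{u + 1})
  map_mul' := by
    rintro ⟨A⟩ ⟨B⟩
    exact Nat.card_prod A.V B.V

theorem stableNumber_le_vertexCount : stableNumber A ≤ vertexCount A := by
  obtain ⟨⟨V, _, G⟩⟩ := A
  exact indepNum_le_natCard G

theorem of_ne_zero {V : Type u} [Finite V] [Nonempty V] (G : SimpleGraph V) : of G ≠ 0 := by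
  intro h
  exact (indepNum_pos G).ne' ((congrArg stableNumber h).trans stableNumber_zero)

variable {A} in
theorem stableNumber_pos (hA : A ≠ 0) : 0 < stableNumber A := by
  obtain ⟨⟨V, _, G⟩⟩ := A
  rcases isEmpty_or_nonempty V with _ | _
  · have G_iso_empty : (⟨V, ‹_›, G⟩ : FinGraph.{u}) ≈ FinGraph.empty :=
      ⟨⟨Equiv.equivPEmpty V, fun {x} => isEmptyElim x⟩⟩
    exact absurd (Quotient.sound G_iso_empty) hA
  · exact indepNum_pos G

theorem stableNumber_one : stableNumber (1 : GraphClass.{u}) = 1 :=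
  le_antisymm ((stableNumber_le_vertexCount 1).trans_eq (map_one vertexCount))
    (indepNum_pos (⊥ : SimpleGraph PUnit.{u + 1}))

theorem stableNumber_pow_le (k : ℕ) : stableNumber A ^ k ≤ stableNumber (A ^ k) := by
  induction k with
  | zero => simp only [pow_zero, stableNumber_one, le_refl]
  | succ k ih =>
    rw [pow_succ, pow_succ]
    exact (Nat.mul_le_mul_right _ ih).trans (stableNumber_mul_le _ _)

end StableNumber

section ShannonCapacity

variable (A B : GraphClass.{u})

theorem bddAbove_range_stableNumber_rpow : BddAbove (Set.range fun k : ℕ+ =>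
    (stableNumber (A ^ (k : ℕ)) : ℝ) ^ (1 / ((k : ℕ) : ℝ))) := by
  refine bddAbove_def.2 ⟨vertexCount A, Set.forall_mem_range.2 fun k => ?_⟩
  rw [rpow_one_div_pnat_le_iff (Nat.cast_nonneg _) (Nat.cast_nonneg _)]
  exact_mod_cast (stableNumber_le_vertexCount _).trans_eq (map_pow vertexCount A k)

theorem shannonCapacity_nonneg : 0 ≤ shannonCapacity A :=
  Real.iSup_nonneg fun _ => by positivity

variable {A} in
theorem shannonCapacity_le_iff {t : ℝ} (ht : 0 ≤ t) :
    shannonCapacity A ≤ t ↔ ∀ k : ℕ, (stableNumber (A ^ k) : ℝ) ≤ t ^ k := by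
  rw [shannonCapacity, ciSup_le_iff (bddAbove_range_stableNumber_rpow A)]
  simp only [rpow_one_div_pnat_le_iff (Nat.cast_nonneg _) ht]
  refine ⟨fun h k => ?_, fun h k => h k⟩
  rcases k.eq_zero_or_pos with rfl | hk
  · simp only [pow_zero, stableNumber_one, Nat.cast_one, le_refl]
  · exact h ⟨k, hk⟩

theorem stableNumber_pow_le_shannonCapacity_pow (k : ℕ) :
    (stableNumber (A ^ k) : ℝ) ≤ shannonCapacity A ^ k :=
  (shannonCapacity_le_iff (shannonCapacity_nonneg A)).1 le_rfl k

theorem stableNumber_le_shannonCapacity : (stableNumber A : ℝ) ≤ shannonCapacity A := by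
  simpa only [pow_one] using stableNumber_pow_le_shannonCapacity_pow A 1

theorem shannonCapacity_zero : shannonCapacity (0 : GraphClass.{u}) = 0 := by
  refine le_antisymm ((shannonCapacity_le_iff le_rfl).2 fun k => ?_) (shannonCapacity_nonneg 0)
  rcases k.eq_zero_or_pos with rfl | hk
  · simp only [pow_zero, stableNumber_one, Nat.cast_one, le_refl]
  · simp only [zero_pow hk.ne', stableNumber_zero, Nat.cast_zero, le_refl]

variable {A} in
theorem shannonCapacity_pos (hA : A ≠ 0) : 0 < shannonCapacity A :=
  (Nat.cast_pos.2 (stableNumber_pos hA)).trans_le (stableNumber_le_shannonCapacity A)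

variable {A} in
theorem le_shannonCapacity_of_forall_mul_pow_le {C x : ℝ} (hC : 0 < C)
    (h : ∀ k : ℕ, C * x ^ k ≤ stableNumber (A ^ k)) : x ≤ shannonCapacity A :=
  le_of_forall_mul_pow_le_pow hC (shannonCapacity_nonneg A) fun k =>
    (h k).trans (stableNumber_pow_le_shannonCapacity_pow A k)

theorem exists_forall_mul_pow_le_stableNumber {r : ℝ} (hr : r ∈ Set.Ioo 0 1) :
    ∃ C > 0, ∀ k : ℕ, C * (r * shannonCapacity A) ^ k ≤ stableNumber (A ^ k) := by
  rcases eq_or_ne A 0 with rfl | hA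
  · refine ⟨1, one_pos, fun k => ?_⟩
    rcases k.eq_zero_or_pos with rfl | hk
    · simp [stableNumber_one]
    · simp [shannonCapacity_zero, stableNumber_zero, hk.ne']
  have hs : 0 ≤ r * shannonCapacity A := mul_nonneg hr.1.le (shannonCapacity_nonneg A)
  have hlt : r * shannonCapacity A < shannonCapacity A :=
    mul_lt_of_lt_one_left (shannonCapacity_pos hA) hr.2
  obtain ⟨a, ha⟩ := exists_lt_of_lt_ciSup hlt
  refine exists_forall_mul_pow_le_of_supermultiplicative (fun k => ?_) (fun k l => ?_) hs a.ne_zero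
    (not_le.1 ((rpow_one_div_pnat_le_iff (Nat.cast_nonneg _) hs a).not.1 ha.not_ge)).le
  · exact_mod_cast (pow_pos (stableNumber_pos hA) k).trans_le (stableNumber_pow_le A k)
  · rw [pow_add]
    exact_mod_cast stableNumber_mul_le _ _

theorem add_le_shannonCapacity_add :
    shannonCapacity A + shannonCapacity B ≤ shannonCapacity (A + B) := by
  suffices h : ∀ r ∈ Set.Ioo (0 : ℝ) 1,
      r * shannonCapacity A + r * shannonCapacity B ≤ shannonCapacity (A + B) by
    simpa only [one_mul] using le_of_continuousAt_of_forall_mem_Ioo one_pos (by fun_prop) h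
  intro r hr
  obtain ⟨C, hC, hCA⟩ := exists_forall_mul_pow_le_stableNumber A hr
  obtain ⟨D, hD, hDB⟩ := exists_forall_mul_pow_le_stableNumber B hr
  set s := r * shannonCapacity A
  set t := r * shannonCapacity B
  have ht : 0 ≤ t := mul_nonneg hr.1.le (shannonCapacity_nonneg B)
  refine le_shannonCapacity_of_forall_mul_pow_le (mul_pos hC hD) fun k => ?_
  calc C * D * (s + t) ^ k
      = ∑ i ∈ Finset.range (k + 1), k.choose i * ((C * s ^ i) * (D * t ^ (k - i))) := by
        rw [add_pow, Finset.mul_sum]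
        exact Finset.sum_congr rfl fun i _ => by ring
    _ ≤ ∑ i ∈ Finset.range (k + 1),
          k.choose i * (stableNumber (A ^ i) * stableNumber (B ^ (k - i)) : ℝ) := by
        gcongr
        · exact hCA _
        · exact hDB _
    _ ≤ ∑ i ∈ Finset.range (k + 1), k.choose i * (stableNumber (A ^ i * B ^ (k - i)) : ℝ) := by
        gcongr
        exact_mod_cast stableNumber_mul_le _ _
    _ = stableNumber ((A + B) ^ k) := by
        rw [add_pow, stableNumber_sum]
        simp only [mul_comm _ (Nat.cast _ : GraphClass.{u}), ← nsmul_eq_mul, stableNumber_nsmul]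
        push_cast
        simp only [nsmul_eq_mul]

theorem mul_le_shannonCapacity_mul :
    shannonCapacity A * shannonCapacity B ≤ shannonCapacity (A * B) := by
  suffices h : ∀ r ∈ Set.Ioo (0 : ℝ) 1,
      (r * shannonCapacity A) * (r * shannonCapacity B) ≤ shannonCapacity (A * B) by
    simpa only [one_mul] using le_of_continuousAt_of_forall_mem_Ioo one_pos (by fun_prop) h
  intro r hr
  obtain ⟨C, hC, hCA⟩ := exists_forall_mul_pow_le_stableNumber A hr
  obtain ⟨D, hD, hDB⟩ := exists_forall_mul_pow_le_stableNumber B hr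
  have ht : 0 ≤ r * shannonCapacity B := mul_nonneg hr.1.le (shannonCapacity_nonneg B)
  refine le_shannonCapacity_of_forall_mul_pow_le (mul_pos hC hD) fun k => ?_
  calc C * D * (r * shannonCapacity A * (r * shannonCapacity B)) ^ k
      = (C * (r * shannonCapacity A) ^ k) * (D * (r * shannonCapacity B) ^ k) := by
        rw [mul_pow]; ring
    _ ≤ stableNumber (A ^ k) * stableNumber (B ^ k) := by
        gcongr
        · exact hCA k
        · exact hDB k
    _ ≤ stableNumber ((A * B) ^ k) := by
        rw [mul_pow]
        exact_mod_cast stableNumber_mul_le _ _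

theorem shannonCapacity_pow_le (k : ℕ) : shannonCapacity (A ^ k) ≤ shannonCapacity A ^ k := by
  refine (shannonCapacity_le_iff (pow_nonneg (shannonCapacity_nonneg A) k)).2 fun l => ?_
  rw [← pow_mul, ← pow_mul]
  exact stableNumber_pow_le_shannonCapacity_pow A (k * l)

end ShannonCapacity

end GraphClass

open MvPolynomial GraphClass

section Monomials

variable {σ R : Type*} [CommSemiring R]

theorem exists_le_nsmul_of_support_subset {e m : σ →₀ ℕ} (h : e.support ⊆ m.support) :
    ∃ k : ℕ, e ≤ k • m := by
  refine ⟨e.degree, fun i => ?_⟩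
  by_cases hi : e i = 0
  · simp [hi]
  have hmi : m i ≠ 0 := Finsupp.mem_support_iff.1 (h (Finsupp.mem_support_iff.2 hi))
  exact (Finsupp.le_degree i e).trans (Nat.le_mul_of_pos_right _ hmi.bot_lt)

theorem support_sum_support (p : MvPolynomial σ R) : (∑ m ∈ p.support, m).support = p.vars := by
  ext i
  simp [mem_vars_iff_mem_support, Finsupp.finsetSum_apply]

theorem aeval_eq_sum_coeff_smul {S : Type*} [CommSemiring S] [Algebra R S] (x : σ → S)
    (p : MvPolynomial σ R) :
    aeval x p = ∑ m ∈ p.support, coeff m p • aeval x (monomial m (1 : R)) := by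
  conv_lhs => rw [p.as_sum, map_sum]
  exact Finset.sum_congr rfl fun m _ => by rw [← map_smul, smul_monomial, smul_eq_mul, mul_one]

theorem exists_eq_monomial_coeff_add (p : MvPolynomial σ R) (m : σ →₀ ℕ) :
    ∃ r, p = monomial m (coeff m p) + r :=
  ⟨_, (AddMonoidAlgebra.single_add_erase m p).symm⟩

variable [PartialOrder R] [CanonicallyOrderedAdd R] [NoZeroDivisors R]

theorem add_mem_support_mul {p q : MvPolynomial σ R} {m n : σ →₀ ℕ} (hm : m ∈ p.support)
    (hn : n ∈ q.support) : m + n ∈ (p * q).support := by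
  classical
  rw [mem_support_iff] at *
  rw [coeff_mul, Ne, Finset.sum_eq_zero_iff]
  exact fun h => mul_ne_zero hm hn (h (m, n) (by simp))

theorem sum_mem_support_prod [Nontrivial R] {ι : Type*} (s : Finset ι) (f : ι → MvPolynomial σ R)
    (m : ι → σ →₀ ℕ) (h : ∀ i ∈ s, m i ∈ (f i).support) :
    ∑ i ∈ s, m i ∈ (∏ i ∈ s, f i).support := by
  induction s using Finset.cons_induction with
  | empty => simp
  | cons a s ha ih =>
    rw [Finset.sum_cons, Finset.prod_cons]
    exact add_mem_support_mul (h a (Finset.mem_cons_self a s))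
      (ih fun i hi => h i (Finset.mem_cons_of_mem hi))

end Monomials

section Exactness

variable {σ : Type*} (A : σ → GraphClass.{u})

/-- `p` is capacity-exact at a family `A` of graphs if `Θ(p(A)) = p(Θ(A))`. The index type `σ` of
the variables may be infinite, and graphs without vertices are allowed. -/
def IsCapacityExact (p : MvPolynomial σ ℕ) : Prop :=
  shannonCapacity (aeval A p) = aeval (fun i => shannonCapacity (A i)) p

theorem aeval_shannonCapacity_le (p : MvPolynomial σ ℕ) :
    aeval (fun i => shannonCapacity (A i)) p ≤ shannonCapacity (aeval A p) := by
  induction p using MvPolynomial.induction_on with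
  | C c =>
    have h := stableNumber_le_shannonCapacity (c • (1 : GraphClass.{u}))
    rw [stableNumber_nsmul, stableNumber_one, mul_one] at h
    simpa using h
  | add p q hp hq =>
    rw [map_add, map_add]
    exact (add_le_add hp hq).trans (add_le_shannonCapacity_add _ _)
  | mul_X p i hp =>
    rw [map_mul, map_mul, aeval_X, aeval_X]
    exact (mul_le_mul_of_nonneg_right hp (shannonCapacity_nonneg _)).trans
      (mul_le_shannonCapacity_mul _ _)

theorem aeval_shannonCapacity_nonneg (p : MvPolynomial σ ℕ) :
    0 ≤ aeval (fun i => shannonCapacity (A i)) p := by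
  rw [aeval_eq_sum_coeff_smul]
  simp only [aeval_monomial, map_one, one_mul]
  exact Finset.sum_nonneg fun m _ => nsmul_nonneg
    (Finset.prod_nonneg fun i _ => pow_nonneg (shannonCapacity_nonneg _) _) _

variable {A} {p q : MvPolynomial σ ℕ}

theorem isCapacityExact_iff_le :
    IsCapacityExact A p ↔
      shannonCapacity (aeval A p) ≤ aeval (fun i => shannonCapacity (A i)) p :=
  ⟨fun h => h.le, fun h => h.antisymm (aeval_shannonCapacity_le A p)⟩

namespace IsCapacityExact

theorem pow (hp : IsCapacityExact A p) (k : ℕ) : IsCapacityExact A (p ^ k) := by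
  rw [isCapacityExact_iff_le, map_pow, map_pow, ← hp]
  exact shannonCapacity_pow_le _ k

theorem of_add (h : IsCapacityExact A (p + q)) : IsCapacityExact A p := by
  rw [isCapacityExact_iff_le, map_add, map_add] at h
  rw [isCapacityExact_iff_le]
  linarith [add_le_shannonCapacity_add (aeval A p) (aeval A q), aeval_shannonCapacity_le A q]

theorem of_mul (h : IsCapacityExact A (p * q))
    (hq : 0 < aeval (fun i => shannonCapacity (A i)) q) : IsCapacityExact A p := by
  rw [isCapacityExact_iff_le, map_mul, map_mul] at h
  refine isCapacityExact_iff_le.2 (le_of_mul_le_mul_right ?_ hq)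
  calc shannonCapacity (aeval A p) * aeval (fun i => shannonCapacity (A i)) q
      ≤ shannonCapacity (aeval A p) * shannonCapacity (aeval A q) :=
        mul_le_mul_of_nonneg_left (aeval_shannonCapacity_le A q) (shannonCapacity_nonneg _)
    _ ≤ shannonCapacity (aeval A p * aeval A q) := mul_le_shannonCapacity_mul _ _
    _ ≤ _ := h

theorem monomial_of_mem_support (hp : IsCapacityExact A p) {m : σ →₀ ℕ} (hm : m ∈ p.support) :
    IsCapacityExact A (monomial m 1) := by
  obtain ⟨r, hr⟩ := exists_eq_monomial_coeff_add p m
  have hc : monomial m (coeff m p) = monomial m 1 * C (coeff m p) := by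
    rw [mul_comm, C_mul_monomial, mul_one]
  rw [hr, hc] at hp
  refine hp.of_add.of_mul ?_
  rw [aeval_C, eq_natCast]
  exact Nat.cast_pos.2 (mem_support_iff.1 hm).bot_lt

theorem monomial_of_le {e m : σ →₀ ℕ} (hm : IsCapacityExact A (monomial m 1)) (he : e ≤ m)
    (hA : ∀ i ∈ m.support, A i ≠ 0) : IsCapacityExact A (monomial e 1) := by
  obtain ⟨d, rfl⟩ := exists_add_of_le he
  rw [← one_mul (1 : ℕ), ← monomial_mul] at hm
  refine hm.of_mul ?_
  rw [aeval_monomial, map_one, one_mul]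
  exact Finset.prod_pos fun i hi => pow_pos (shannonCapacity_pos (hA i
    (Finsupp.support_mono le_add_self hi))) _

theorem monomial_of_support_subset_vars (hp : IsCapacityExact A p) (hA : ∀ i ∈ p.vars, A i ≠ 0)
    {e : σ →₀ ℕ} (he : e.support ⊆ p.vars) : IsCapacityExact A (monomial e 1) := by
  let m := ∑ v ∈ p.support, v
  have hm : m ∈ (p ^ p.support.card).support := by
    simpa using sum_mem_support_prod p.support (fun _ => p) id fun _ => id
  have hmv : m.support = p.vars := support_sum_support p
  obtain ⟨k, hk⟩ := exists_le_nsmul_of_support_subset (he.trans_eq hmv.symm)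
  have hkm : IsCapacityExact A (monomial (k • m) 1) := by
    simpa only [monomial_pow, one_pow] using ((hp.pow _).monomial_of_mem_support hm).pow k
  exact hkm.monomial_of_le hk fun i hi => hA i (hmv ▸ Finsupp.support_smul hi)

end IsCapacityExact

theorem stableNumber_aeval_le (h : ∀ m ∈ p.support, IsCapacityExact A (monomial m 1)) :
    (stableNumber (aeval A p) : ℝ) ≤ aeval (fun i => shannonCapacity (A i)) p := by
  rw [aeval_eq_sum_coeff_smul A, aeval_eq_sum_coeff_smul, stableNumber_sum, Nat.cast_sum]
  refine Finset.sum_le_sum fun m hm => ?_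
  rw [stableNumber_nsmul, Nat.cast_mul, nsmul_eq_mul, ← h m hm]
  exact mul_le_mul_of_nonneg_left (stableNumber_le_shannonCapacity _) (Nat.cast_nonneg _)

theorem isCapacityExact_of_forall_monomial
    (h : ∀ m : σ →₀ ℕ, m.support ⊆ p.vars → IsCapacityExact A (monomial m 1)) :
    IsCapacityExact A p := by
  rw [isCapacityExact_iff_le, shannonCapacity_le_iff (aeval_shannonCapacity_nonneg A p)]
  intro k
  rw [← map_pow, ← map_pow]
  refine stableNumber_aeval_le fun m hm => h m fun i hi => ?_
  exact vars_pow p k (mem_vars_iff_mem_support i |>.2 ⟨m, hm, hi⟩)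

theorem IsCapacityExact.of_vars_subset (hp : IsCapacityExact A p) (hA : ∀ i ∈ p.vars, A i ≠ 0)
    (hq : q.vars ⊆ p.vars) : IsCapacityExact A q :=
  isCapacityExact_of_forall_monomial fun _ hm =>
    hp.monomial_of_support_subset_vars hA (hm.trans hq)

end Exactness

theorem mainTheorem2_general {σ : Type*} (A : σ → GraphClass.{u}) (s : Finset σ)
    (hA : ∀ i ∈ s, A i ≠ 0) :
    (∀ p : MvPolynomial σ ℕ, p.vars ⊆ s → IsCapacityExact A p) ↔
      ∃ p : MvPolynomial σ ℕ, IsCapacityExact A p ∧ p.vars = s := by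
  constructor
  · intro h
    have hs : (∑ i ∈ s, X i : MvPolynomial σ ℕ).vars = s := by
      classical
      have hdisj : Pairwise (Function.onFun Disjoint fun i => (X i : MvPolynomial σ ℕ).vars) :=
        fun i j hij => by simpa [Function.onFun] using hij
      rw [vars_sum_of_disjoint s _ hdisj]
      simp
    exact ⟨_, h _ hs.subset, hs⟩
  · rintro ⟨p, hp, rfl⟩ q hq
    exact hp.of_vars_subset hA hq

theorem mainTheorem2 {n : ℕ} {V : Fin n → Type u} [∀ i, Finite (V i)] [∀ i, Nonempty (V i)]
    (G : ∀ i, SimpleGraph (V i)) :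
    capacityPolynomials G = Set.univ ↔
      ∃ p ∈ capacityPolynomials G, ∀ i, i ∈ p.vars := by
  simpa [capacityPolynomials, IsCapacityExact, Set.eq_univ_iff_forall,
    Finset.eq_univ_iff_forall] using
    mainTheorem2_general (fun i => of (G i)) Finset.univ fun i _ => of_ne_zero (G i)
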